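/- Let $m > 2$ and $n > 3$ be integers and let $\mathbb{Z}_m=\{0,1,\dots,m-1\}$. For $\mathbf{x},\mathbf{y}\in\mathbb{Z}_m^n$, let the fixed-length Levenshtein distance $d_l(\mathbf{x},\mathbf{y})$ be the smallest integer $t\ge 0$ such that some word of length $n-t$ can be obtained both from $\mathbf{x}$ and from $\mathbf{y}$ by deleting $t$ symbols, and let $L_1(\mathbf{x})=\{\mathbf{y}\in\mathbb{Z}_m^n : d_l(\mathbf{x},\mathbf{y})\le 1\}$. Let $x_1,\dots,x_n$ be independent random variables with $\Pr(x_i=j)=\frac1m$ for all $1\le i\le n$ and $j\in\mathbb{Z}_m$, and let $\mathbf{x}=x_1\cdots x_n$. Then $$\mathbb{E}\big[|L_1(\mathbf{x})|\big] = n^2\Big(m+\frac1m-2\Big)+2-\frac nm+\frac{m^{n-1}-1}{m^{n-1}(m-1)},$$ and for every real $c>0$, $$\Pr\Big(|L_1(\mathbf{x})|-\mathbb{E}\big[|L_1(\mathbf{x})|\big]\ \ge\ c\Big(m+\frac1m\Big)n\sqrt{n-1}\Big)\le e^{-c^2/2}$$ and $$\Pr\Big(|L_1(\mathbf{x})|-\mathbb{E}\big[|L_1(\mathbf{x})|\big]\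 \le\ -c\Big(m+\frac1m\Big)n\sqrt{n-1}\Big)\le e^{-c^2/2}.$$ -/

import Mathlib

open MeasureTheory ProbabilityTheory

/-- `FLL.Word m n` is the set of words of length `n` over the alphabet `{0, ..., m - 1}`. -/
abbrev FLL.Word (m n : ℕ) : Type := Fin n → Fin m

/-- The deletion `t`-sphere centered at `x`: all words of length exactly `n - t` that are
(not necessarily contiguous) subsequences of `x`; it is empty if `t > n`. -/
def FLL.deletionSphere {m n : ℕ} (t : ℕ) (x : FLL.Word m n) : Set (List (Fin m)) :=
  {l | l.Sublist (List.ofFn x) ∧ l.length + t = n}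

/-- Deleting all symbols gives the empty word, so the set of which the distance is the least
element is never empty. -/
theorem FLL.exists_common_subsequence {m n : ℕ} (x y : FLL.Word m n) :
    {t : ℕ | (FLL.deletionSphere t x ∩ FLL.deletionSphere t y).Nonempty}.Nonempty :=
  ⟨n, [], ⟨List.nil_sublist _, by simp⟩, ⟨List.nil_sublist _, by simp⟩⟩

/-- The fixed-length Levenshtein distance: the smallest `t` such that the deletion `t`-spheres of
`x` and `y` intersect. -/
noncomputable def FLL.dist {m n : ℕ} (x y : FLL.Word m n) : ℕ :=
  sInf {t : ℕ | (FLL.deletionSphere t x ∩ FLL.deletionSphere t y).Nonempty}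

/-- The fixed-length Levenshtein ball of radius `t` centered at `x`. -/
def FLL.ball {m n : ℕ} (t : ℕ) (x : FLL.Word m n) : Set (FLL.Word m n) :=
  {y | FLL.dist x y ≤ t}

/-- The number of words in the ball of radius `t` centered at `x` (a finite set). -/
noncomputable def FLL.ballSize {m n : ℕ} (t : ℕ) (x : FLL.Word m n) : ℕ :=
  (FLL.ball t x).ncard

/-!
The ball size has a closed form. A word `y ≠ x` of the same length lies in the ball of radius one
if and only if it arises from `x` by one deletion and one insertion. There are `runs x` deletions,
each of them followed by `n (m - 1)` insertions that do not lead back to `x`, and a word `y` is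
reached at most twice; it is reached twice exactly when `y` differs from `x` in exchanging the two
letters of an alternating segment of `x` of length at least `2`. Hence
`|L₁(x)| = 1 + n (m - 1) runs x - altTotal x`, where `altTotal x` counts these segments. This is
`FLL.ballSize_one`. Its proof is a recursion on the first letter (`FLL.wordCount_near`): for words
`a :: x` and `b :: y` with `a ≠ b`, being near means that `y` is a subsequence of `a :: x` or `x`
is a subsequence of `b :: y`, and the three counts needed for inclusion and exclusion are the number
of runs, a number depending only on the length, and `1 + altLen`.

Now reveal a uniform random word from its last letter to its first. Since the number `altLen` of
alternating segments at the left end grows by one, becomes `1`, or becomes `0` with probabilities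
that can be taken independent of it (the first two coincide when it is `0`), the conditional mean of the ball size is affine in `altLen` and explicit
(`FLL.condMean`). Its value before any letter is revealed is the expectation. Its increments are at
most `(m + 1 / m) n` in absolute value (`FLL.abs_condMean_cons_sub_le`), and the first of them is
`0`, so the Azuma–Hoeffding argument (`FLL.sum_word_exp_le`) shows that the deviation is
sub-Gaussian with variance proxy `(n - 1) ((m + 1 / m) n) ^ 2`. The tail bounds are the Chernoff
bounds for it.
-/

namespace FLL

/-! ### Counting words letter by letter -/

section Counting

variable {α : Type*}

theorem sum_word_succ [Fintype α] {M : Type*} [AddCommMonoid M] (k : ℕ) (g : List α → M) :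
    ∑ w : Fin (k + 1) → α, g (List.ofFn w) = ∑ c, ∑ w : Fin k → α, g (c :: List.ofFn w) := by
  rw [← Fintype.sum_prod_type' (f := fun c (w : Fin k → α) => g (c :: List.ofFn w))]
  refine (Fintype.sum_equiv (Fin.consEquiv fun _ => α) _ _ ?_).symm
  rintro ⟨c, w⟩
  simp [Fin.consEquiv, List.ofFn_succ]

theorem sum_eq_add_card_mul [Fintype α] [DecidableEq α] (a : α) (g : α → ℝ) (v : ℝ)
    (h : ∀ b, b ≠ a → g b = v) :
    ∑ b, g b = g a + ((Fintype.card α : ℝ) - 1) * v := by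
  rw [← Finset.add_sum_erase _ _ (Finset.mem_univ a),
    Finset.sum_congr rfl fun b hb => h b (Finset.ne_of_mem_erase hb), Finset.sum_const,
    Finset.card_erase_of_mem (Finset.mem_univ a), nsmul_eq_mul, Finset.card_univ,
    Nat.cast_sub (Fintype.card_pos_iff.2 ⟨a⟩), Nat.cast_one]

open Classical in
/-- The number of words of length `k` that satisfy `p`, as a real number. -/
noncomputable def wordCount [Fintype α] (k : ℕ) (p : List α → Prop) : ℝ :=
  ∑ w : Fin k → α, if p (List.ofFn w) then 1 else 0

variable [Fintype α]

theorem wordCount_succ (k : ℕ) (p : List α → Prop) :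
    wordCount (k + 1) p = ∑ c, wordCount k fun y => p (c :: y) := by
  classical
  exact sum_word_succ k fun y => if p y then (1 : ℝ) else 0

theorem wordCount_congr {k : ℕ} {p q : List α → Prop} (h : ∀ y, y.length = k → (p y ↔ q y)) :
    wordCount k p = wordCount k q := by
  classical
  exact Finset.sum_congr rfl fun w _ => if_congr (h _ (by simp)) rfl rfl

theorem wordCount_zero (p : List α → Prop) [Decidable (p [])] :
    wordCount 0 p = if p [] then 1 else 0 := by
  simp [wordCount]

theorem wordCount_false (k : ℕ) : wordCount k (fun _ : List α => False) = 0 := by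
  simp [wordCount]

theorem wordCount_or (k : ℕ) (p q : List α → Prop) :
    wordCount k (fun y => p y ∨ q y) =
      wordCount k p + wordCount k q - wordCount k fun y => p y ∧ q y := by
  unfold wordCount
  rw [← Finset.sum_add_distrib, ← Finset.sum_sub_distrib]
  refine Finset.sum_congr rfl fun w _ => ?_
  by_cases hp : p (List.ofFn w) <;> by_cases hq : q (List.ofFn w) <;> simp [hp, hq]

theorem wordCount_eq_self (l : List α) : wordCount l.length (· = l) = 1 := by
  classical
  induction l with
  | nil => simp [wordCount_zero]
  | cons a l ih =>
    rw [List.length_cons, wordCount_succ, sum_eq_add_card_mul a _ 0]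
    · simpa using ih
    · intro b hb
      simpa [hb] using wordCount_false l.length

theorem ncard_setOf_word (k : ℕ) (p : List α → Prop) :
    ({w : Fin k → α | p (List.ofFn w)}.ncard : ℝ) = wordCount k p := by
  classical
  rw [Set.ncard_eq_toFinset_card', wordCount, Finset.sum_boole, Set.toFinset_ofPred]

end Counting

/-! ### Words with a common subsequence obtained by one deletion -/

section Near

variable {α : Type*}

theorem cons_sublist_cons_of_ne {a b : α} (h : a ≠ b) (x y : List α) :
    (a :: x).Sublist (b :: y) ↔ (a :: x).Sublist y := by
  refine ⟨fun hs => ?_, fun hs => hs.cons b⟩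
  cases hs with
  | cons _ h' => exact h'
  | cons_cons _ _ => exact absurd rfl h

theorem sublist_iff_eq_of_length_eq {x y : List α} (h : x.length = y.length) :
    x.Sublist y ↔ x = y :=
  ⟨fun hs => hs.eq_of_length h, fun e => e ▸ List.Sublist.refl _⟩

/-- Two words are *near* if deleting at most one letter from each can make them equal.
The length condition is on `x` only, as the words compared have equal length. -/
def Near (x y : List α) : Prop :=
  ∃ l : List α, l.Sublist x ∧ l.Sublist y ∧ x.length ≤ l.length + 1

theorem near_cons_self (a : α) (x y : List α) : Near (a :: x) (a :: y) ↔ Near x y := by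
  constructor
  · rintro ⟨l, hx, hy, hl⟩
    refine ⟨l.tail, by simpa using hx.tail, by simpa using hy.tail, ?_⟩
    simp only [List.length_cons, List.length_tail] at *
    omega
  · rintro ⟨l, hx, hy, hl⟩
    exact ⟨a :: l, hx.cons_cons a, hy.cons_cons a, by simpa using hl⟩

/-- If the first letters differ, a common subsequence that misses only one letter of each word
must drop one of the first letters, and then it is one of the tails. -/
theorem near_cons_of_ne {a b : α} (hab : a ≠ b) {x y : List α} (h : x.length = y.length) :
    Near (a :: x) (b :: y) ↔ y.Sublist (a :: x) ∨ x.Sublist (b :: y) := by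
  constructor
  · rintro ⟨l, hx, hy, hl⟩
    simp only [List.length_cons, Nat.add_le_add_iff_right] at hl
    cases hx with
    | cons _ hx' => exact Or.inr (hx'.eq_of_length_le hl ▸ hy)
    | cons_cons _ hx' =>
      rw [cons_sublist_cons_of_ne hab] at hy
      exact Or.inl (hy.eq_of_length_le (h ▸ hl) ▸ hx'.cons_cons a)
  · rintro (hs | hs)
    · exact ⟨y, hs, List.sublist_cons_self _ _, by simp [h]⟩
    · exact ⟨x, List.sublist_cons_self _ _, hs, by simp⟩

end Near

/-! ### The size of a ball of radius one -/

section Combinatorics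

variable {α : Type*} [DecidableEq α]

/-- The number of runs (maximal blocks of equal consecutive letters) of a word. -/
def runs : List α → ℕ
  | [] => 0
  | [_] => 1
  | a :: b :: x => runs (b :: x) + if a = b then 0 else 1

/-- The number of prefixes of length at least `2` that alternate between two distinct letters.
In the last clause `x.head? = some a` says that the word starts `a, b, a`, so that the alternating
prefixes of `b :: x` extend to the left. -/
def altLen : List α → ℕ
  | [] => 0
  | [_] => 0
  | a :: b :: x => if a = b then 0 else 1 + if x.head? = some a then altLen (b :: x) else 0

/-- The number of pairs of positions `i < j` such that the letters from `i` to `j` alternate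
between two distinct letters. -/
def altTotal : List α → ℕ
  | [] => 0
  | a :: x => altLen (a :: x) + altTotal x

theorem altLen_eq_zero {b : α} {l : List α} (h : l.head? = some b) : altLen (b :: l) = 0 := by
  cases l <;> simp_all [altLen]

theorem altLen_le (x : List α) : altLen x ≤ x.length := by
  fun_induction altLen x <;> grind

variable [Fintype α]

/-- The number of words obtained from `z` by inserting one letter depends only on the length
of `z`. -/
theorem wordCount_superseq (z : List α) :
    wordCount (z.length + 1) (fun y => z.Sublist y) =
      ((z.length : ℝ) + 1) * ((Fintype.card α : ℝ) - 1) + 1 := by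
  induction z with
  | nil => simp [wordCount_succ, wordCount_zero]
  | cons a z ih =>
    rw [wordCount_succ, sum_eq_add_card_mul a _ 1]
    · simp only [List.cons_sublist_cons, List.length_cons]
      rw [ih]; push_cast; ring
    · intro b hb
      rw [← wordCount_eq_self (a :: z)]
      refine wordCount_congr fun y hy => ?_
      rw [cons_sublist_cons_of_ne hb.symm, sublist_iff_eq_of_length_eq hy.symm, eq_comm]

theorem sum_wordCount_eq (a e : α) (x : List α) :
    ∑ c ∈ Finset.univ.erase a, wordCount x.length (fun y => c :: y = e :: x) =
      if a = e then 0 else 1 := by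
  have h : ∀ c, wordCount x.length (fun y => c :: y = e :: x) = if c = e then 1 else 0 := by
    intro c
    by_cases hc : c = e
    · simpa [hc] using wordCount_eq_self x
    · simpa [hc] using wordCount_false x.length
  simp only [h, Finset.sum_ite_eq', Finset.mem_erase, Finset.mem_univ, and_true]
  by_cases hae : a = e <;> simp [hae, eq_comm]

/-- Deleting a letter of a word gives as many different words as the word has runs. -/
theorem wordCount_subseq (a : α) (x : List α) :
    wordCount x.length (fun y => y.Sublist (a :: x)) = runs (a :: x) := by
  induction x generalizing a with
  | nil => simp [wordCount_zero, runs]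
  | cons e x ih =>
    rw [List.length_cons, wordCount_succ, ← Finset.add_sum_erase _ _ (Finset.mem_univ a)]
    simp only [List.cons_sublist_cons]
    rw [ih, Finset.sum_congr rfl (g := fun c => wordCount x.length fun y => c :: y = e :: x),
      sum_wordCount_eq, runs]
    · push_cast; rfl
    · intro c hc
      refine wordCount_congr fun y hy => ?_
      rw [cons_sublist_cons_of_ne (Finset.ne_of_mem_erase hc),
        sublist_iff_eq_of_length_eq (by simp [hy])]

/-- The overlap between the two ways in which a word `b :: y` can be near `a :: b :: x`. If `x` starts with
`a`, the words `a :: y` in the count are those with `y` in the count for `b :: a :: x.tail`; this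
recursion is the one that defines `altLen`. -/
theorem wordCount_between {a b : α} (hab : a ≠ b) (x : List α) :
    wordCount (x.length + 1) (fun y => y.Sublist (a :: b :: x) ∧ x.Sublist y) =
      1 + altLen (a :: b :: x) := by
  induction hk : x.length generalizing a b x with
  | zero => 
    rw [List.length_eq_zero_iff] at hk
    subst hk
    simpa [altLen, hab, runs, one_add_one_eq_two] using wordCount_subseq a [b]
  | succ k ih => 
    rw [← hk, wordCount_succ, ← Finset.add_sum_erase _ _ (Finset.mem_univ a)]
    rw [Finset.sum_congr rfl (g := fun c => wordCount x.length fun y => c :: y = b :: x),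
      sum_wordCount_eq, if_neg hab, altLen, if_neg hab]
    · simp only [List.cons_sublist_cons]
      by_cases hx : x.head? = some a
      · obtain ⟨x', rfl⟩ : ∃ x', x = a :: x' := by
          cases x <;> simp_all
        simp only [List.cons_sublist_cons, List.length_cons, List.head?_cons, if_true]
        rw [List.length_cons, Nat.add_right_cancel_iff] at hk
        rw [hk, ih hab.symm x' hk]
        push_cast; ring
      · rw [if_neg hx, ← wordCount_eq_self x]
        obtain ⟨e, x', rfl⟩ : ∃ e x', x = e :: x' := by
          cases x <;> simp_all
        rw [wordCount_congr (q := (· = e :: x'))]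
        · rw [wordCount_eq_self]; norm_num
        · intro y hy
          have hea : e ≠ a := by simpa using hx
          rw [cons_sublist_cons_of_ne hea, sublist_iff_eq_of_length_eq hy.symm, eq_comm]
          refine ⟨And.right, fun h => ⟨?_, h⟩⟩
          rw [h]; exact List.sublist_cons_self _ _
    · intro c hc
      refine wordCount_congr fun y hy => ?_
      rw [cons_sublist_cons_of_ne (Finset.ne_of_mem_erase hc),
        sublist_iff_eq_of_length_eq (by simp [hy])]
      refine ⟨And.left, fun h => ⟨h, ?_⟩⟩
      rw [h]; exact List.sublist_cons_self _ _

theorem wordCount_near_of_ne {a b : α} (hab : a ≠ b) (x : List α) :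
    wordCount x.length (fun y => Near (a :: x) (b :: y)) = runs (a :: x) +
      if x.head? = some b then
        (x.length : ℝ) * ((Fintype.card α : ℝ) - 1) - altLen (a :: x) else 0 := by
  rw [wordCount_congr fun y hy => near_cons_of_ne hab hy.symm]
  -- If `x` starts with `b`, the two alternatives are counted by inclusion and exclusion;
  -- otherwise the second one forces `y = x` and is contained in the first.
  split_ifs with hx
  · obtain ⟨x, rfl⟩ : ∃ x', x = b :: x' := by
      cases x <;> simp_all
    simp only [List.cons_sublist_cons]
    rw [wordCount_or, wordCount_subseq, List.length_cons, wordCount_superseq,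
      wordCount_between hab]
    push_cast; ring
  · rw [add_zero, ← wordCount_subseq]
    refine wordCount_congr fun y hy => ⟨?_, Or.inl⟩
    rintro (h | h)
    · exact h
    · suffices y = x by rw [this]; exact List.sublist_cons_self _ _
      cases x with
      | nil => simpa using hy
      | cons e x =>
        rw [cons_sublist_cons_of_ne (by simpa using hx)] at h
        exact (h.eq_of_length hy.symm).symm

/-- The size of a ball of radius one: each of the `runs x` deletions can be followed by an
insertion, and the words reached twice correspond to the alternating segments of `x`. -/
theorem wordCount_near (x : List α) :
    wordCount x.length (Near x) =
      1 + x.length * ((Fintype.card α : ℝ) - 1) * runs x - altTotal x := by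
  classical
  induction x with
  | nil => simp [wordCount_zero, runs, altTotal, Near]
  | cons a x ih =>
    rw [List.length_cons, wordCount_succ, ← Finset.add_sum_erase _ _ (Finset.mem_univ a)]
    simp only [near_cons_self]
    rw [ih, Finset.sum_congr rfl fun b hb =>
      wordCount_near_of_ne (Finset.ne_of_mem_erase hb).symm x]
    rw [Finset.sum_add_distrib, Finset.sum_const, Finset.card_erase_of_mem (Finset.mem_univ a),
      nsmul_eq_mul, Finset.card_univ, Nat.cast_sub (Fintype.card_pos_iff.2 ⟨a⟩), Nat.cast_one,
      altTotal]
    cases x with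
    | nil => simp [runs, altLen, altTotal]
    | cons e x =>
      simp only [List.head?_cons, Option.some.injEq, Finset.sum_ite_eq, Finset.mem_erase,
        Finset.mem_univ, and_true, runs, List.length_cons]
      by_cases hae : a = e
      · subst hae
        simp [altLen]; ring
      · simp [hae, Ne.symm hae]; ring

end Combinatorics

theorem dist_le_one_iff {m n : ℕ} (x y : Word m n) :
    dist x y ≤ 1 ↔ Near (List.ofFn x) (List.ofFn y) := by
  constructor
  · intro h
    obtain ⟨l, ⟨hx, hl⟩, hy, -⟩ := Nat.sInf_mem (exists_common_subsequence x y)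
    refine ⟨l, hx, hy, ?_⟩
    change l.length + dist x y = n at hl
    simp only [List.length_ofFn]; omega
  · rintro ⟨l, hx, hy, hl⟩
    have hle := hx.length_le
    simp only [List.length_ofFn] at hl hle
    have h : n - l.length ∈
        {t : ℕ | (deletionSphere t x ∩ deletionSphere t y).Nonempty} :=
      ⟨l, ⟨hx, by omega⟩, hy, by omega⟩
    exact (Nat.sInf_le h).trans (by omega)

theorem ballSize_one {m n : ℕ} (x : Word m n) :
    (ballSize 1 x : ℝ) = 1 + n * ((m : ℝ) - 1) * runs (List.ofFn x) - altTotal (List.ofFn x) := by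
  have h := wordCount_near (List.ofFn x)
  rw [List.length_ofFn, Fintype.card_fin] at h
  rw [← h, ← ncard_setOf_word, ballSize, ball]
  simp only [dist_le_one_iff]

/-! ### Martingales on the uniform space of words -/

section Concentration

/-- The graph of `exp` on `[-|x|, |x|]` lies below its chord. -/
theorem exp_mul_le_cosh_add {x y : ℝ} (hy : |y| ≤ 1) :
    Real.exp (x * y) ≤ Real.cosh x + y * Real.sinh x := by
  obtain ⟨h1, h2⟩ := abs_le.1 hy
  have ha : 0 ≤ (1 + y) / 2 := by linarith
  have hb : 0 ≤ (1 - y) / 2 := by linarith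
  have h := convexOn_exp.right (Set.mem_univ x) (Set.mem_univ (-x)) ha hb (by ring)
  simp only [smul_eq_mul] at h
  rw [Real.cosh_eq, Real.sinh_eq]
  calc Real.exp (x * y) = Real.exp ((1 + y) / 2 * x + (1 - y) / 2 * -x) := by ring_nf
    _ ≤ _ := h
    _ = _ := by ring

/-- Hoeffding's lemma for a centred function on a finite uniform space. -/
theorem sum_exp_le {α : Type*} [Fintype α] {d : α → ℝ} {K : ℝ} (hd : ∑ c, d c = 0)
    (hK : ∀ c, |d c| ≤ K) (s : ℝ) :
    ∑ c, Real.exp (s * d c) ≤ Fintype.card α * Real.exp (s ^ 2 / 2 * K ^ 2) := by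
  have hle : ∀ c, Real.exp (s * d c) ≤
      Real.exp (s ^ 2 / 2 * K ^ 2) + d c * (Real.sinh (s * K) / K) := by
    intro c
    have hK0 : 0 ≤ K := (abs_nonneg _).trans (hK c)
    have hcosh : Real.cosh (s * K) ≤ Real.exp (s ^ 2 / 2 * K ^ 2) := by
      refine (Real.cosh_le_exp_half_sq _).trans_eq ?_
      ring_nf
    -- For `K = 0` the quotient is a junk value, but then `d c = 0` as well.
    have heq : s * d c = s * K * (d c / K) := by
      rcases hK0.eq_or_lt with h | h
      · have : d c = 0 := abs_nonpos_iff.1 ((hK c).trans_eq h.symm)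
        simp [this]
      · field_simp
    rw [heq]
    refine (exp_mul_le_cosh_add ?_).trans ?_
    · rw [abs_div, abs_of_nonneg hK0]
      exact div_le_one_of_le₀ (hK c) hK0
    · rw [div_mul_eq_mul_div, mul_div_assoc]
      gcongr
  refine (Finset.sum_le_sum fun c _ => hle c).trans_eq ?_
  rw [Finset.sum_add_distrib, ← Finset.sum_mul, hd, Finset.sum_const, Finset.card_univ,
    nsmul_eq_mul, zero_mul, add_zero]

variable {α : Type*} [Fintype α] {F : List α → ℝ}

/-- The words are revealed from the last letter to the first, so that `F (c :: l)` follows `F l`;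
`hF` says that `F` is then a martingale for uniform letters. -/
theorem sum_word_eq (n : ℕ)
    (hF : ∀ l : List α, l.length < n → ∑ c, F (c :: l) = Fintype.card α * F l) :
    ∑ w : Fin n → α, F (List.ofFn w) = (Fintype.card α : ℝ) ^ n * F [] := by
  induction n with
  | zero => simp
  | succ n ih =>
    rw [sum_word_succ, Finset.sum_comm, Finset.sum_congr rfl fun w _ => hF _ (by simp),
      ← Finset.mul_sum, ih fun l hl => hF l (hl.trans n.lt_succ_self)]
    ring

/-- The Azuma–Hoeffding bound for the moment generating function of a martingale with increments
bounded by `K 0, …, K (n - 1)`. -/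
theorem sum_word_exp_le {K : ℕ → ℝ} (n : ℕ)
    (hF : ∀ l : List α, l.length < n → ∑ c, F (c :: l) = Fintype.card α * F l)
    (hK : ∀ (l : List α) (c : α), l.length < n → |F (c :: l) - F l| ≤ K l.length) (s : ℝ) :
    ∑ w : Fin n → α, Real.exp (s * (F (List.ofFn w) - F [])) ≤
      (Fintype.card α : ℝ) ^ n * Real.exp (s ^ 2 / 2 * ∑ i ∈ Finset.range n, K i ^ 2) := by
  induction n with
  | zero => simp
  | succ n ih =>
    have hstep : ∀ w : Fin n → α, ∑ c, Real.exp (s * (F (c :: List.ofFn w) - F [])) ≤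
        Fintype.card α * Real.exp (s ^ 2 / 2 * K n ^ 2) *
          Real.exp (s * (F (List.ofFn w) - F [])) := by
      intro w
      have hlen : (List.ofFn w).length = n := by simp
      have h := sum_exp_le (d := fun c => F (c :: List.ofFn w) - F (List.ofFn w)) (K := K n)
        (by
          rw [Finset.sum_sub_distrib, hF _ (by simp)]
          simp)
        (fun c => (hK _ c (by simp)).trans_eq (by rw [hlen])) s
      refine le_trans (le_of_eq ?_)
        (mul_le_mul_of_nonneg_right h (Real.exp_pos (s * (F (List.ofFn w) - F []))).le)
      rw [Finset.sum_mul]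
      refine Finset.sum_congr rfl fun c _ => ?_
      rw [← Real.exp_add]
      ring_nf
    rw [sum_word_succ n fun l => Real.exp (s * (F l - F [])), Finset.sum_comm]
    refine (Finset.sum_le_sum fun w _ => hstep w).trans ?_
    rw [← Finset.mul_sum]
    refine (mul_le_mul_of_nonneg_left (ih (fun l hl => hF l (hl.trans n.lt_succ_self))
      (fun l c hl => hK l c (hl.trans n.lt_succ_self))) (by positivity)).trans_eq ?_
    rw [Finset.sum_range_succ, mul_add, Real.exp_add]
    ring

end Concentration

/-! ### Independent uniform letters -/

section Uniform

variable {m n : ℕ} {Ω : Type*} [MeasurableSpace Ω] {P : Measure Ω} [IsProbabilityMeasure P]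
  {X : Fin n → Ω → Fin m}

theorem integral_comp_word (hmeas : ∀ i, Measurable (X i)) (hindep : iIndepFun X P)
    (hunif : ∀ (i : Fin n) (j : Fin m), P.real {ω | X i ω = j} = 1 / (m : ℝ))
    (f : Word m n → ℝ) :
    ∫ ω, f (fun i => X i ω) ∂P = (∑ w, f w) / (m : ℝ) ^ n := by
  have hX : Measurable fun ω i => X i ω := measurable_pi_lambda _ hmeas
  have hpt : ∀ w : Word m n, (P.map fun ω i => X i ω).real {w} = (1 / (m : ℝ)) ^ n := by
    intro w
    rw [map_measureReal_apply hX (measurableSet_singleton w)]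
    have hset : (fun ω i => X i ω) ⁻¹' {w} = ⋂ i ∈ Finset.univ, X i ⁻¹' {w i} := by
      ext ω
      simp [funext_iff]
    rw [hset, measureReal_def, hindep.measure_inter_preimage_eq_mul Finset.univ
      (fun i _ => measurableSet_singleton (w i)), ENNReal.toReal_prod]
    have h : ∀ i, (P (X i ⁻¹' {w i})).toReal = 1 / (m : ℝ) := fun i => hunif i (w i)
    simp [h]
  have : IsProbabilityMeasure (P.map fun ω i => X i ω) :=
    Measure.isProbabilityMeasure_map hX.aemeasurable
  rw [← integral_map (f := f) hX.aemeasurable (measurable_of_countable f).aestronglyMeasurable,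
    integral_fintype (Integrable.of_finite)]
  simp only [hpt, smul_eq_mul]
  rw [← Finset.mul_sum, one_div, inv_pow]
  ring

theorem integrable_comp_word (hmeas : ∀ i, Measurable (X i)) (f : Word m n → ℝ) :
    Integrable (fun ω => f fun i => X i ω) P := by
  have hX : Measurable fun ω i => X i ω := measurable_pi_lambda _ hmeas
  have : IsProbabilityMeasure (P.map fun ω i => X i ω) :=
    Measure.isProbabilityMeasure_map hX.aemeasurable
  exact (Integrable.of_finite (f := f) (μ := P.map fun ω i => X i ω)).comp_measurable hX

theorem hasSubgaussianMGF_comp_word (hmeas : ∀ i, Measurable (X i)) (hindep : iIndepFun X P)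
    (hunif : ∀ (i : Fin n) (j : Fin m), P.real {ω | X i ω = j} = 1 / (m : ℝ)) (hm : 0 < m)
    {g : Word m n → ℝ} {V : NNReal}
    (hg : ∀ s : ℝ, ∑ w, Real.exp (s * g w) ≤ (m : ℝ) ^ n * Real.exp (s ^ 2 / 2 * V)) :
    HasSubgaussianMGF (fun ω => g fun i => X i ω) V P where
  integrable_exp_mul s := integrable_comp_word hmeas fun w => Real.exp (s * g w)
  mgf_le s := by
    have hm' : (0 : ℝ) < m := by exact_mod_cast hm
    rw [mgf, integral_comp_word hmeas hindep hunif fun w => Real.exp (s * g w),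
      div_le_iff₀ (by positivity)]
    refine (hg s).trans_eq ?_
    ring_nf

end Uniform

/-! ### The conditional means of the ball size -/

section Martingale

variable {α : Type*} [Fintype α] [DecidableEq α]

theorem sum_runs_cons (b : α) (l : List α) :
    ∑ c, (runs (c :: b :: l) : ℝ) =
      Fintype.card α * runs (b :: l) + ((Fintype.card α : ℝ) - 1) := by
  rw [sum_eq_add_card_mul b _ (runs (b :: l) + 1)]
  · simp [runs]; ring
  · intro c hc
    simp [runs, hc]

theorem sum_altLen_cons (b : α) (l : List α) :
    ∑ c, (altLen (c :: b :: l) : ℝ) = altLen (b :: l) + ((Fintype.card α : ℝ) - 1) := by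
  have h : ∀ c, (altLen (c :: b :: l) : ℝ) = (if c = b then 0 else 1) +
      if l.head? = some c then (altLen (b :: l) : ℝ) else 0 := by
    intro c
    by_cases hcb : c = b
    · subst hcb
      by_cases hl : l.head? = some c
      · simp [altLen, altLen_eq_zero hl]
      · simp [altLen, hl]
    · simp [altLen, hcb]
  simp only [h]
  rw [Finset.sum_add_distrib, sum_eq_add_card_mul b _ 1 (by simp +contextual)]
  cases l with
  | nil => simp [altLen]
  | cons e l => simp; ring

/-- The geometric sum `q⁻¹ + q⁻² + ⋯ + q⁻ᴺ`. Each of the alternating prefixes present extends to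
the left through the next `j` random letters with probability `q⁻ʲ`, so this is
the expected number of alternating segments it still produces in `N` steps. -/
noncomputable def geomTail (q : ℝ) (N : ℕ) : ℝ := (1 - (1 / q) ^ N) / (q - 1)

theorem geomTail_succ {q : ℝ} (hq : 1 < q) (N : ℕ) :
    geomTail q (N + 1) = (1 + geomTail q N) / q := by
  have h1 : q - 1 ≠ 0 := by linarith
  have h2 : q ≠ 0 := by linarith
  unfold geomTail
  rw [pow_succ]
  field_simp
  ring

theorem geomTail_nonneg {q : ℝ} (hq : 1 < q) (N : ℕ) : 0 ≤ geomTail q N := by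
  have : (1 / q) ^ N ≤ 1 := pow_le_one₀ (by positivity) (by
    rw [div_le_one (by linarith)]; exact hq.le)
  exact div_nonneg (by linarith) (by linarith)

theorem geomTail_mul_le {q : ℝ} (hq : 1 < q) (N : ℕ) : geomTail q N * (q - 1) ≤ 1 := by
  have : 0 ≤ (1 / q) ^ N := by positivity
  rw [geomTail, div_mul_cancel₀ _ (by linarith)]
  linarith

/-- The mean of the size of the ball of radius one around a uniform random word of length `n > 0`,
given that the word ends with the argument. It is affine in `altLen`, and the only other data of
the known suffix that enter are its length, its number of runs and its number of alternating
segments. The empty suffix is a separate case because the first letter revealed starts a run with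
certainty, each later one only with probability `1 - 1 / card α`. -/
noncomputable def condMean (n : ℕ) : List α → ℝ
  | [] => 1 + ((n : ℝ) - 1) * (n * ((Fintype.card α : ℝ) - 1) ^ 2 / Fintype.card α - 1)
      + geomTail (Fintype.card α) (n - 1) + n * ((Fintype.card α : ℝ) - 1)
  | a :: l => 1 + ((n : ℝ) - (l.length + 1)) *
        (n * ((Fintype.card α : ℝ) - 1) ^ 2 / Fintype.card α - 1)
      + geomTail (Fintype.card α) (n - (l.length + 1))
      + n * ((Fintype.card α : ℝ) - 1) * runs (a :: l) - altTotal (a :: l)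
      - geomTail (Fintype.card α) (n - (l.length + 1)) * altLen (a :: l)

theorem condMean_singleton (n : ℕ) (c : α) : condMean n [c] = condMean n ([] : List α) := by
  simp [condMean, runs, altLen, altTotal]

theorem condMean_of_length_eq {n : ℕ} {l : List α} (hn : 0 < n) (hl : l.length = n) :
    condMean n l = 1 + n * ((Fintype.card α : ℝ) - 1) * runs l - altTotal l := by
  subst hl
  cases l with
  | nil => simp at hn
  | cons a l => simp [condMean, geomTail]

/-- The increments of the martingale: the deviations of the number of runs and of `altLen` from
their conditional means, with their weights. -/
theorem condMean_cons_sub (n : ℕ) (hq : 1 < (Fintype.card α : ℝ)) (c b : α) (l : List α)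
    (hl : (b :: l).length < n) :
    condMean n (c :: b :: l) - condMean n (b :: l) =
      n * ((Fintype.card α : ℝ) - 1) *
          (((runs (c :: b :: l) : ℝ) - runs (b :: l)) - (1 - 1 / Fintype.card α)) -
        (1 + geomTail (Fintype.card α) (n - (l.length + 2))) *
          (altLen (c :: b :: l) -
            (altLen (b :: l) + ((Fintype.card α : ℝ) - 1)) / Fintype.card α) := by
  obtain ⟨N, hN⟩ : ∃ N, n = l.length + 2 + N := Nat.exists_eq_add_of_le hl
  have h1 : n - (l.length + 1) = N + 1 := by omega
  have h2 : n - (l.length + 2) = N := by omega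
  have h3 : geomTail (Fintype.card α) N * ((Fintype.card α : ℝ) - 1) =
    Fintype.card α * geomTail (Fintype.card α) (N + 1) * ((Fintype.card α : ℝ) - 1) - 
      ((Fintype.card α : ℝ) - 1) := by
    rw [geomTail_succ hq]
    field_simp
    ring
  have h4 := geomTail_succ hq N
  simp only [condMean, List.length_cons, h1, h2, altTotal]
  rw [h4]
  have hq0 : (Fintype.card α : ℝ) ≠ 0 := by linarith
  push_cast
  field_simp
  ring

theorem sum_condMean_cons (n : ℕ) (hq : 1 < (Fintype.card α : ℝ)) (l : List α)
    (hl : l.length < n) :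
    ∑ c, condMean n (c :: l) = Fintype.card α * condMean n l := by
  cases l with
  | nil => simp [condMean_singleton]
  | cons b l =>
    have hq0 : (Fintype.card α : ℝ) ≠ 0 := by linarith
    suffices h : ∑ c, (condMean n (c :: b :: l) - condMean n (b :: l)) = 0 by
      rw [Finset.sum_sub_distrib, Finset.sum_const, Finset.card_univ, nsmul_eq_mul] at h
      linarith
    simp only [condMean_cons_sub n hq _ b l hl]
    rw [Finset.sum_sub_distrib, ← Finset.mul_sum, ← Finset.mul_sum, Finset.sum_sub_distrib,
      Finset.sum_sub_distrib, Finset.sum_sub_distrib, Finset.sum_sub_distrib, sum_runs_cons,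
      sum_altLen_cons]
    simp only [Finset.sum_const, Finset.card_univ, nsmul_eq_mul]
    field_simp
    ring

theorem abs_condMean_cons_sub_le (n : ℕ) (hq : 3 ≤ (Fintype.card α : ℝ)) (c b : α) (l : List α)
    (hl : (b :: l).length < n) :
    |condMean n (c :: b :: l) - condMean n (b :: l)| ≤
      ((Fintype.card α : ℝ) + 1 / Fintype.card α) * n := by
  have hq1 : 1 < (Fintype.card α : ℝ) := by linarith
  rw [condMean_cons_sub n hq1 c b l hl]
  have hg0 := geomTail_nonneg hq1 (n - (l.length + 2))
  have hg1 := geomTail_mul_le hq1 (n - (l.length + 2))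
  have ha : (altLen (b :: l) : ℝ) + 1 ≤ n := by
    exact_mod_cast (Nat.add_le_add_right (altLen_le (b :: l)) 1).trans hl
  have ha0 : (0 : ℝ) ≤ altLen (b :: l) := Nat.cast_nonneg _
  set a : ℝ := (altLen (b :: l) : ℝ)
  set q : ℝ := (Fintype.card α : ℝ)
  set g := geomTail q (n - (l.length + 2))
  have hstep : ((runs (c :: b :: l) : ℝ) - runs (b :: l) = 0 ∧ (altLen (c :: b :: l) : ℝ) = 0) ∨
      ((runs (c :: b :: l) : ℝ) - runs (b :: l) = 1 ∧
        ((altLen (c :: b :: l) : ℝ) = 1 ∨ (altLen (c :: b :: l) : ℝ) = 1 + a)) := by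
    by_cases hcb : c = b
    · simp [runs, altLen, hcb]
    · right
      by_cases hl : l.head? = some c <;> simp [runs, altLen, hcb, hl, a]
  have hq0 : 0 < q := by linarith
  have hn : (1 : ℝ) ≤ n := by linarith
  have hg : g ≤ 1 / 2 := by nlinarith
  have hga0 : 0 ≤ g * a := mul_nonneg hg0 ha0
  have hga : g * a ≤ 1 / 2 * a := mul_le_mul_of_nonneg_right hg ha0
  have hgqa : g * (q - 1) * a ≤ 1 * a := mul_le_mul_of_nonneg_right hg1 ha0
  have hgqa0 : 0 ≤ g * (q - 1) * a := by
    have : 0 ≤ q - 1 := by linarith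
    positivity
  have hgq0 : 0 ≤ g * (q - 1) := mul_nonneg hg0 (by linarith)
  have hqn : 3 * (n : ℝ) ≤ q * n := mul_le_mul_of_nonneg_right hq (by linarith)
  have hqqn : 3 * (q * n) ≤ q * (q * n) := mul_le_mul_of_nonneg_right hq (by positivity)
  have hqa : q * (a + 1) ≤ q * n := mul_le_mul_of_nonneg_left ha hq0.le
  have hqa0 : 0 ≤ q * a := by positivity
  generalize (runs (c :: b :: l) : ℝ) - runs (b :: l) = δ at hstep ⊢
  generalize (altLen (c :: b :: l) : ℝ) = a' at hstep ⊢
  have hD : n * (q - 1) * (δ - (1 - 1 / q)) - (1 + g) * (a' - (a + (q - 1)) / q) =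
      (n * (q - 1) * (q * δ - (q - 1)) - (1 + g) * (q * a' - (a + (q - 1)))) / q := by
    field_simp
  have hB : (q + 1 / q) * n = (q ^ 2 + 1) * n / q := by
    field_simp
  rw [hD, hB, abs_div, abs_of_pos hq0]
  gcongr
  rw [abs_le]
  -- The new letter repeats the last one, breaks the alternation, or continues it.
  obtain ⟨rfl, rfl⟩ | ⟨rfl, rfl | rfl⟩ := hstep <;> constructor <;> nlinarith

end Martingale

end FLL

theorem theorem3p5 (m n : ℕ) (hm : 2 < m) (hn : 3 < n)
    {Ω : Type*} [MeasurableSpace Ω] (P : Measure Ω) [IsProbabilityMeasure P]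
    (X : Fin n → Ω → Fin m)
    (hmeas : ∀ i, Measurable (X i))
    (hindep : iIndepFun X P)
    (hunif : ∀ (i : Fin n) (j : Fin m), P.real {ω | X i ω = j} = 1 / (m : ℝ)) :
    Integrable (fun ω => (FLL.ballSize 1 (fun i => X i ω) : ℝ)) P ∧
    ∫ ω, (FLL.ballSize 1 (fun i => X i ω) : ℝ) ∂P =
      (n : ℝ) ^ 2 * ((m : ℝ) + 1 / (m : ℝ) - 2) + 2 - (n : ℝ) / (m : ℝ)
        + ((m : ℝ) ^ (n - 1) - 1) / ((m : ℝ) ^ (n - 1) * ((m : ℝ) - 1)) ∧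
    ∀ c : ℝ, 0 < c →
      P.real {ω | (FLL.ballSize 1 (fun i => X i ω) : ℝ)
            - ∫ ω', (FLL.ballSize 1 (fun i => X i ω') : ℝ) ∂P
          ≥ c * ((m : ℝ) + 1 / (m : ℝ)) * (n : ℝ) * Real.sqrt ((n : ℝ) - 1)}
        ≤ Real.exp (-c ^ 2 / 2) ∧
      P.real {ω | (FLL.ballSize 1 (fun i => X i ω) : ℝ)
            - ∫ ω', (FLL.ballSize 1 (fun i => X i ω') : ℝ) ∂P
          ≤ -(c * ((m : ℝ) + 1 / (m : ℝ)) * (n : ℝ) * Real.sqrt ((n : ℝ) - 1))}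
        ≤ Real.exp (-c ^ 2 / 2) := by
  have hm3 : (3 : ℝ) ≤ m := by exact_mod_cast hm
  have hn1 : (0 : ℝ) < (n : ℝ) - 1 := by
    have : (3 : ℝ) < n := by exact_mod_cast hn
    linarith
  have hcard : (Fintype.card (Fin m) : ℝ) = m := by simp
  have hq1 : 1 < (Fintype.card (Fin m) : ℝ) := by linarith
  have hball : ∀ w : FLL.Word m n,
      (FLL.ballSize 1 w : ℝ) = FLL.condMean n (List.ofFn w) := by
    intro w
    rw [FLL.ballSize_one, FLL.condMean_of_length_eq (by omega) (by simp), hcard]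
  have hmart := FLL.sum_condMean_cons (α := Fin m) n hq1
  have hmean : ∫ ω, (FLL.ballSize 1 (fun i => X i ω) : ℝ) ∂P =
      FLL.condMean n ([] : List (Fin m)) := by
    rw [FLL.integral_comp_word hmeas hindep hunif fun w => (FLL.ballSize 1 w : ℝ)]
    simp only [hball]
    rw [FLL.sum_word_eq n hmart, hcard, mul_div_cancel_left₀ _ (by positivity)]
  set K : ℝ := ((m : ℝ) + 1 / m) * n
  have hK0 : 0 < K := by
    have : (0 : ℝ) < n := by linarith
    positivity
  set V : NNReal := ⟨((n : ℝ) - 1) * K ^ 2, by positivity⟩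
  have hV : (V : ℝ) = ((n : ℝ) - 1) * K ^ 2 := rfl
  have hsub : HasSubgaussianMGF (fun ω => (FLL.ballSize 1 (fun i => X i ω) : ℝ) -
      FLL.condMean n ([] : List (Fin m))) V P := by
    refine FLL.hasSubgaussianMGF_comp_word hmeas hindep hunif (by omega)
      (g := fun w => (FLL.ballSize 1 w : ℝ) - FLL.condMean n ([] : List (Fin m))) fun s => ?_
    simp only [hball]
    -- The first letter revealed does not change the conditional mean, by the symmetry of the
    -- alphabet: only `n - 1` increments count, hence the factor `n - 1` instead of `n`.
    refine (FLL.sum_word_exp_le (K := fun i => if i = 0 then 0 else K) n hmart ?_ s).trans_eq ?_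
    · rintro (_ | ⟨b, l⟩) c hl
      · simp [FLL.condMean_singleton]
      · simpa [K] using FLL.abs_condMean_cons_sub_le n (by rw [hcard]; exact hm3) c b l hl
    · rw [hV]
      obtain ⟨N, rfl⟩ : ∃ N, n = N + 1 := ⟨n - 1, by omega⟩
      rw [Finset.sum_range_succ']
      simp
  rw [hmean]
  have hdev : ∀ c : ℝ, -(c * K * Real.sqrt ((n : ℝ) - 1)) ^ 2 / (2 * V) = -c ^ 2 / 2 := by
    intro c
    rw [hV, mul_pow, Real.sq_sqrt hn1.le]
    field_simp
  refine ⟨FLL.integrable_comp_word hmeas fun w => (FLL.ballSize 1 w : ℝ), ?_, fun c hc => ?_⟩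
  · rw [FLL.condMean, FLL.geomTail, hcard, one_div, inv_pow]
    have : (m : ℝ) - 1 ≠ 0 := by linarith
    field_simp
    ring
  · have heq : c * ((m : ℝ) + 1 / m) * n * Real.sqrt ((n : ℝ) - 1) =
        c * K * Real.sqrt ((n : ℝ) - 1) := by
      simp only [K]; ring
    have ht : 0 ≤ c * K * Real.sqrt ((n : ℝ) - 1) := by positivity
    rw [heq, ← hdev c]
    refine ⟨hsub.measure_ge_le ht, ?_⟩
    refine le_trans (le_of_eq ?_) (hsub.neg.measure_ge_le ht)
    congr 1
    ext ω
    simp only [Set.mem_ofPred_eq, Pi.neg_apply, le_neg]
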